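/- Let $\Gamma$ be Euler's gamma function and let $\psi(x)=\Gamma'(x)/\Gamma(x)$ for $x>0$. A function $f$ is called completely monotonic on an interval $I$ if it has derivatives of all orders on $I$ and $(-1)^n f^{(n)}(x)\ge 0$ for all $x\in I$ and all integers $n\ge 0$. For $\lambda\in\mathbb{R}$ and $x>0$ let $$f_\lambda(x)=[\psi'(x)]^2+\psi''(x)-\frac{x^2+\lambda x+12}{12x^4(x+1)^2}.$$ 1. For every $\lambda\in\mathbb{R}$, the function $f_\lambda$ is completely monotonic on $(0,\infty)$ if and only if $\lambda\le 0$. 2. For every $\lambda\in\mathbb{R}$, the function $-f_\lambda$ is completely monotonic on $(0,\infty)$ if and only if $\lambda\ge 4$. 3. For all $\mu,\nu\in\mathbb{R}$, the double inequality $$\frac{x^2+\mu x+12}{12x^4(x+1)^2}<[\psi'(x)]^2+\psi''(x)<\frac{x^2+\nu x+12}{12x^4(x+1)^2}$$ holds for all $x\in(0,\infty)$ if and only if $\mu\le 0$ and $\nu\ge 4$. -/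

import Mathlib

open scoped ContDiff

/-- The psi (digamma) function `ψ(x) = Γ'(x) / Γ(x)` of a real variable. -/
noncomputable def psi (x : ℝ) : ℝ := deriv Real.Gamma x / Real.Gamma x

/-- `f` is completely monotonic on `I`: it has derivatives of all orders on `I` and
`(-1)ⁿ f⁽ⁿ⁾(x) ≥ 0` for all `x ∈ I` and all `n ≥ 0`. -/
def CompletelyMonotonicOn (f : ℝ → ℝ) (I : Set ℝ) : Prop :=
  ContDiffOn ℝ ∞ f I ∧
    ∀ n : ℕ, ∀ x ∈ I, 0 ≤ (-1 : ℝ) ^ n * iteratedDerivWithin n f I x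

/-- The rational function `(x² + c x + 12) / (12 x⁴ (x + 1)²)`. -/
noncomputable def ratBound (c x : ℝ) : ℝ :=
  (x ^ 2 + c * x + 12) / (12 * x ^ 4 * (x + 1) ^ 2)

/-- The function `[ψ'(x)]² + ψ''(x)`. -/
noncomputable def polygammaComb (x : ℝ) : ℝ :=
  (deriv psi x) ^ 2 + iteratedDeriv 2 psi x

/-- The function `f_lam(x) = [ψ'(x)]² + ψ''(x) - (x² + lam x + 12) / (12 x⁴ (x + 1)²)`. -/
noncomputable def fLam (lam x : ℝ) : ℝ := polygammaComb x - ratBound lam x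

open Filter Topology Set

/-!
Write `F = (ψ')² + ψ''`. The functional equations of `ψ'` and `ψ''` show that
`x² (F x - F (x + 1)) = 2 ψ'(x) - 2 / x - 1 / x²`, and that one further difference of this function
is the rational function `1 / (x² (x + 1)²)`. A function that vanishes at infinity is the sum of its
unit differences, so comparing `F` with a rational function `q` reduces, by telescoping twice, to
comparing `1 / (x² (x + 1)²)` with a rational function.

To telescope complete monotonicity, it is replaced by the nonnegativity of all alternating finite
differences: this condition passes to pointwise limits, and for smooth functions it implies complete
monotonicity.

The constants `0` and `4` are optimal because `F` also lies below a function that agrees with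
`ratBound 0` up to `O(1 / x²)` as `x → 0`, and above a function that agrees with `ratBound 4` up to
`O(1 / x⁶)` as `x → ∞`.
-/

section AlternatingDifferences

/-- The alternating difference `(1 - E^h₁) ⋯ (1 - E^hₙ) f` with steps `h₁, …, hₙ`, where `E^h` is
the shift `f ↦ f (· + h)`. -/
def altDiff : List ℝ → (ℝ → ℝ) → ℝ → ℝ
  | [], f => f
  | h :: hs, f => altDiff hs fun x => f x - f (x + h)

/-- All alternating differences of `f` with positive steps are nonnegative on `(0, ∞)`. This is
complete monotonicity without reference to derivatives; the values of `f` off `(0, ∞)` play no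
role. -/
def AltDiffNonneg (f : ℝ → ℝ) : Prop :=
  ∀ hs : List ℝ, (∀ h ∈ hs, 0 < h) → ∀ x, 0 < x → 0 ≤ altDiff hs f x

variable {f g : ℝ → ℝ}

theorem altDiff_congr (hfg : ∀ x, 0 < x → f x = g x) {hs : List ℝ} (hpos : ∀ h ∈ hs, 0 < h)
    {x : ℝ} (hx : 0 < x) : altDiff hs f x = altDiff hs g x := by
  induction hs generalizing f g with
  | nil => exact hfg x hx
  | cons h hs ih =>
    rw [List.forall_mem_cons] at hpos
    exact ih (fun y hy => by rw [hfg y hy, hfg (y + h) (add_pos hy hpos.1)]) hpos.2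

theorem altDiff_add (hs : List ℝ) (f g : ℝ → ℝ) (x : ℝ) :
    altDiff hs (fun y => f y + g y) x = altDiff hs f x + altDiff hs g x := by
  induction hs generalizing f g with
  | nil => rfl
  | cons h hs ih => simp only [altDiff, add_sub_add_comm, ih]

theorem altDiff_comp_add_right (hs : List ℝ) (f : ℝ → ℝ) (a x : ℝ) :
    altDiff hs (fun y => f (y + a)) x = altDiff hs f (x + a) := by
  induction hs generalizing f with
  | nil => rfl
  | cons h hs ih =>
    simp only [altDiff, add_right_comm _ h a]
    exact ih fun y => f y - f (y + h)

theorem tendsto_altDiff {ι : Type*} {l : Filter ι} {F : ι → ℝ → ℝ}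
    (hF : ∀ x, 0 < x → Tendsto (fun i => F i x) l (𝓝 (f x))) {hs : List ℝ}
    (hpos : ∀ h ∈ hs, 0 < h) {x : ℝ} (hx : 0 < x) :
    Tendsto (fun i => altDiff hs (F i) x) l (𝓝 (altDiff hs f x)) := by
  induction hs generalizing F f with
  | nil => exact hF x hx
  | cons h hs ih =>
    rw [List.forall_mem_cons] at hpos
    exact ih (fun y hy => (hF y hy).sub (hF (y + h) (add_pos hy hpos.1))) hpos.2

namespace AltDiffNonneg

theorem nonneg (hf : AltDiffNonneg f) {x : ℝ} (hx : 0 < x) : 0 ≤ f x :=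
  hf [] (by simp) x hx

theorem congr (hf : AltDiffNonneg f) (hfg : ∀ x, 0 < x → f x = g x) : AltDiffNonneg g :=
  fun hs hpos x hx => (hf hs hpos x hx).trans_eq (altDiff_congr hfg hpos hx)

theorem sub_comp_add_right (hf : AltDiffNonneg f) {h : ℝ} (hh : 0 < h) :
    AltDiffNonneg fun x => f x - f (x + h) :=
  fun hs hpos => hf (h :: hs) (List.forall_mem_cons.2 ⟨hh, hpos⟩)

theorem antitoneOn (hf : AltDiffNonneg f) : AntitoneOn f (Ioi 0) := by
  intro x hx y _ hxy
  obtain rfl | hlt := hxy.eq_or_lt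
  · rfl
  · simpa using (hf.sub_comp_add_right (sub_pos.2 hlt)).nonneg hx

theorem comp_add_right (hf : AltDiffNonneg f) {a : ℝ} (ha : 0 ≤ a) :
    AltDiffNonneg fun x => f (x + a) := fun hs hpos x hx => by
  rw [altDiff_comp_add_right]
  exact hf hs hpos _ (by positivity)

theorem of_tendsto {ι : Type*} {l : Filter ι} [l.NeBot] {F : ι → ℝ → ℝ}
    (hF : ∀ᶠ i in l, AltDiffNonneg (F i))
    (hlim : ∀ x, 0 < x → Tendsto (fun i => F i x) l (𝓝 (f x))) : AltDiffNonneg f :=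
  fun hs hpos x hx => ge_of_tendsto (tendsto_altDiff hlim hpos hx)
    (hF.mono fun _ hi => hi hs hpos x hx)

theorem add (hf : AltDiffNonneg f) (hg : AltDiffNonneg g) :
    AltDiffNonneg fun x => f x + g x := fun hs hpos x hx => by
  rw [altDiff_add]
  exact add_nonneg (hf hs hpos x hx) (hg hs hpos x hx)

theorem mul (hf : AltDiffNonneg f) (hg : AltDiffNonneg g) :
    AltDiffNonneg fun x => f x * g x := by
  intro hs hpos x hx
  induction hs generalizing f g with
  | nil => exact mul_nonneg (hf.nonneg hx) (hg.nonneg hx)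
  | cons h hs ih =>
    rw [List.forall_mem_cons] at hpos
    have leibniz : (fun y => f y * g y - f (y + h) * g (y + h)) =
        fun y => (f y - f (y + h)) * g y + f (y + h) * (g y - g (y + h)) := by
      ext y
      ring
    rw [altDiff, leibniz, altDiff_add]
    exact add_nonneg (ih (hf.sub_comp_add_right hpos.1) hg hpos.2)
      (ih (hf.comp_add_right hpos.1.le) (hg.sub_comp_add_right hpos.1) hpos.2)

theorem const_mul_exp_neg {c t : ℝ} (hc : 0 ≤ c) (ht : 0 ≤ t) :
    AltDiffNonneg fun x => c * Real.exp (-(t * x)) := by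
  intro hs hpos x _
  induction hs generalizing c with
  | nil => exact mul_nonneg hc (Real.exp_pos _).le
  | cons h hs ih =>
    rw [List.forall_mem_cons] at hpos
    have eigenfunction : (fun y => c * Real.exp (-(t * y)) - c * Real.exp (-(t * (y + h)))) =
        fun y => c * (1 - Real.exp (-(t * h))) * Real.exp (-(t * y)) := by
      ext y
      rw [mul_add, neg_add, Real.exp_add]
      ring
    rw [altDiff, eigenfunction]
    have hle : Real.exp (-(t * h)) ≤ 1 :=
      Real.exp_le_one_iff.2 (neg_nonpos.2 (mul_nonneg ht hpos.1.le))
    exact ih (mul_nonneg hc (sub_nonneg.2 hle)) hpos.2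

theorem const {c : ℝ} (hc : 0 ≤ c) : AltDiffNonneg fun _ => c := by
  simpa using const_mul_exp_neg hc le_rfl

theorem pow (hf : AltDiffNonneg f) (k : ℕ) : AltDiffNonneg fun x => f x ^ k := by
  induction k with
  | zero => simpa using const zero_le_one
  | succ k ih => simpa only [pow_succ] using ih.mul hf

theorem sum_range {F : ℕ → ℝ → ℝ} (hF : ∀ k, AltDiffNonneg (F k)) (n : ℕ) :
    AltDiffNonneg fun x => ∑ k ∈ Finset.range n, F k x := by
  induction n with
  | zero => simpa using const le_rfl
  | succ n ih => simpa only [Finset.sum_range_succ] using ih.add (hF n)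

theorem inv_one_sub (hf : AltDiffNonneg f) (hlt : ∀ x, 0 < x → f x < 1) :
    AltDiffNonneg fun x => (1 - f x)⁻¹ :=
  of_tendsto (.of_forall (sum_range hf.pow)) fun x hx =>
    (hasSum_geometric_of_lt_one (hf.nonneg hx) (hlt x hx)).tendsto_sum_nat

-- `1 / x` is the limit of `δ / (1 - exp (-δ x))` as `δ` decreases to `0`.
theorem inv_add {a : ℝ} (ha : 0 ≤ a) : AltDiffNonneg fun x => (x + a)⁻¹ := by
  refine comp_add_right (f := fun x => x⁻¹) (of_tendsto (l := 𝓝[>] (0 : ℝ))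
    (F := fun δ x => δ * (1 - 1 * Real.exp (-(δ * x)))⁻¹) ?_ fun x hx => ?_) ha
  · filter_upwards [self_mem_nhdsWithin] with δ (hδ : 0 < δ)
    refine (const hδ.le).mul (inv_one_sub (const_mul_exp_neg zero_le_one hδ.le) fun x hx => ?_)
    rw [one_mul, Real.exp_lt_one_iff, neg_lt_zero]
    positivity
  · have hderiv : HasDerivAt (fun δ : ℝ => Real.exp (-(δ * x))) (-x) 0 := by
      simpa using ((hasDerivAt_id (0 : ℝ)).mul_const x).neg.exp
    have hlim := hderiv.tendsto_slope_zero_right.neg.inv₀ (by simpa using hx.ne')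
    rw [neg_neg] at hlim
    refine hlim.congr fun δ => ?_
    simp only [zero_add, zero_mul, neg_zero, Real.exp_zero, smul_eq_mul, one_mul]
    rw [← mul_neg, neg_sub, mul_inv, inv_inv]

theorem mul_inv_add_add_const (hf : AltDiffNonneg f) {a c : ℝ} (ha : 0 ≤ a) (hc : 0 ≤ c) :
    AltDiffNonneg fun x => f x * (x + a)⁻¹ + c :=
  (hf.mul (inv_add ha)).add (const hc)

theorem of_hasDerivAt {f' : ℝ → ℝ} (hderiv : ∀ x, 0 < x → HasDerivAt f (f' x) x)
    (hincr : ∀ h, 0 < h → AltDiffNonneg fun x => f (x + h) - f x) : AltDiffNonneg f' := by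
  refine of_tendsto (l := 𝓝[>] (0 : ℝ)) (F := fun h x => h⁻¹ * (f (x + h) - f x)) ?_
    fun x hx => (hderiv x hx).tendsto_slope_zero_right
  filter_upwards [self_mem_nhdsWithin] with h (hh : 0 < h)
  exact (const (inv_nonneg.2 hh.le)).mul (hincr h hh)

theorem neg_hasDerivAt {f' : ℝ → ℝ} (hf : AltDiffNonneg f)
    (hderiv : ∀ x, 0 < x → HasDerivAt f (f' x) x) : AltDiffNonneg fun x => -f' x :=
  of_hasDerivAt (f := fun x => -f x) (fun x hx => (hderiv x hx).neg) fun h hh => by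
    simpa only [neg_sub_neg] using hf.sub_comp_add_right hh

theorem neg_one_pow_mul_iteratedDerivWithin (hf : AltDiffNonneg f)
    (hsmooth : ContDiffOn ℝ ∞ f (Ioi 0)) (n : ℕ) :
    AltDiffNonneg fun x => (-1) ^ n * iteratedDerivWithin n f (Ioi 0) x := by
  induction n with
  | zero => simpa using hf
  | succ n ih =>
    have hderiv : ∀ x : ℝ, 0 < x → HasDerivAt (iteratedDerivWithin n f (Ioi 0))
        (iteratedDerivWithin (n + 1) f (Ioi 0) x) x := fun x hx => by
      rw [iteratedDerivWithin_succ]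
      exact (hsmooth.differentiableOn_iteratedDerivWithin (mod_cast ENat.natCast_lt_top n)
        isOpen_Ioi.uniqueDiffOn x hx).hasDerivWithinAt.hasDerivAt (Ioi_mem_nhds hx)
    exact (ih.neg_hasDerivAt fun x hx => (hderiv x hx).const_mul _).congr fun x _ => by ring

theorem completelyMonotonicOn (hf : AltDiffNonneg f) (hsmooth : ContDiffOn ℝ ∞ f (Ioi 0)) :
    CompletelyMonotonicOn f (Ioi 0) :=
  ⟨hsmooth, fun n _ hx => (hf.neg_one_pow_mul_iteratedDerivWithin hsmooth n).nonneg hx⟩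

end AltDiffNonneg

theorem CompletelyMonotonicOn.nonneg {I : Set ℝ} (hf : CompletelyMonotonicOn f I) {x : ℝ}
    (hx : x ∈ I) : 0 ≤ f x := by
  simpa using hf.2 0 x hx

end AlternatingDifferences

section Telescoping

variable {f g : ℝ → ℝ}

theorem tendsto_sub_add_natCast (hlim : Tendsto f atTop (𝓝 0)) (x : ℝ) :
    Tendsto (fun n : ℕ => f x - f (x + n)) atTop (𝓝 (f x)) := by
  simpa using tendsto_const_nhds.sub
    (hlim.comp (tendsto_atTop_add_const_left _ x tendsto_natCast_atTop_atTop))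

theorem sum_range_sub_add_one (f : ℝ → ℝ) (x : ℝ) (n : ℕ) :
    ∑ k ∈ Finset.range n, (f (x + k) - f (x + k + 1)) = f x - f (x + n) := by
  simpa [add_assoc] using Finset.sum_range_sub' (fun k : ℕ => f (x + k)) n

theorem AltDiffNonneg.of_sub_add_one (hlim : Tendsto f atTop (𝓝 0))
    (hf : AltDiffNonneg fun x => f x - f (x + 1)) : AltDiffNonneg f :=
  of_tendsto (.of_forall (sum_range fun k : ℕ => hf.comp_add_right k.cast_nonneg)) fun x _ => by
    simpa only [sum_range_sub_add_one] using tendsto_sub_add_natCast hlim x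

theorem pos_of_add_one_lt (hlim : Tendsto f atTop (𝓝 0)) (hf : ∀ x, 0 < x → f (x + 1) < f x)
    {x : ℝ} (hx : 0 < x) : 0 < f x := by
  have hnonneg : ∀ y, 0 < y → 0 ≤ f y := fun y hy =>
    ge_of_tendsto' (tendsto_sub_add_natCast hlim y) fun n => by
      rw [← sum_range_sub_add_one]
      exact Finset.sum_nonneg fun k _ => sub_nonneg.2 (hf (y + k) (by positivity)).le
  exact (hnonneg (x + 1) (by positivity)).trans_lt (hf x hx)

/-- The weighted difference `x² (f x - f (x + 1))`. The weight `x²` is chosen so that for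
`f = (ψ')² + ψ''` the result is `2 ψ'` plus a rational function. -/
def sqDiff (f : ℝ → ℝ) (x : ℝ) : ℝ := x ^ 2 * (f x - f (x + 1))

/-- The unit difference of `sqDiff f`, a second-order difference operator that sends
`(ψ')² + ψ''` to the rational function `1 / (x² (x + 1)²)`. -/
def sqDiffDiff (f : ℝ → ℝ) (x : ℝ) : ℝ := sqDiff f x - sqDiff f (x + 1)

theorem sqDiff_sub (f g : ℝ → ℝ) : sqDiff (f - g) = sqDiff f - sqDiff g := by
  ext x
  simp only [sqDiff, Pi.sub_apply]
  ring

theorem sqDiffDiff_sub (f g : ℝ → ℝ) : sqDiffDiff (f - g) = sqDiffDiff f - sqDiffDiff g := by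
  ext x
  simp only [sqDiffDiff, sqDiff_sub, Pi.sub_apply]
  ring

theorem AltDiffNonneg.of_sqDiffDiff (hlim : Tendsto f atTop (𝓝 0))
    (hlim' : Tendsto (sqDiff f) atTop (𝓝 0)) (hf : AltDiffNonneg (sqDiffDiff f)) :
    AltDiffNonneg f := by
  refine of_sub_add_one hlim (((of_sub_add_one hlim' hf).mul ((inv_add le_rfl).pow 2)).congr
    fun x hx => ?_)
  rw [sqDiff]
  field_simp
  ring

theorem pos_of_sqDiffDiff_pos (hlim : Tendsto f atTop (𝓝 0))
    (hlim' : Tendsto (sqDiff f) atTop (𝓝 0)) (hf : ∀ x, 0 < x → 0 < sqDiffDiff f x) {x : ℝ}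
    (hx : 0 < x) : 0 < f x := by
  refine pos_of_add_one_lt hlim (fun y hy => ?_) hx
  have hpos : 0 < sqDiff f y := pos_of_add_one_lt hlim' (fun z hz => sub_pos.1 (hf z hz)) hy
  exact sub_pos.1 (pos_of_mul_pos_right hpos (sq_nonneg y))

theorem AltDiffNonneg.sub_of_sqDiffDiff (hf : Tendsto f atTop (𝓝 0))
    (hf' : Tendsto (sqDiff f) atTop (𝓝 0)) (hg : Tendsto g atTop (𝓝 0))
    (hg' : Tendsto (sqDiff g) atTop (𝓝 0)) (hfg : AltDiffNonneg (sqDiffDiff f - sqDiffDiff g)) :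
    AltDiffNonneg (f - g) := by
  refine of_sqDiffDiff ?_ ?_ (by rwa [sqDiffDiff_sub])
  · simpa using! hf.sub hg
  · rw [sqDiff_sub]
    simpa using! hf'.sub hg'

theorem lt_of_sqDiffDiff_lt (hf : Tendsto f atTop (𝓝 0)) (hf' : Tendsto (sqDiff f) atTop (𝓝 0))
    (hg : Tendsto g atTop (𝓝 0)) (hg' : Tendsto (sqDiff g) atTop (𝓝 0))
    (hfg : ∀ x, 0 < x → sqDiffDiff f x < sqDiffDiff g x) {x : ℝ} (hx : 0 < x) : f x < g x := by
  refine sub_pos.1 (pos_of_sqDiffDiff_pos (f := g - f) ?_ ?_ (fun y hy => ?_) hx)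
  · simpa using! hg.sub hf
  · rw [sqDiff_sub]
    simpa using! hg'.sub hf'
  · rw [sqDiffDiff_sub]
    exact sub_pos.2 (hfg y hy)

theorem tendsto_of_tendsto_sq_mul (hf : Tendsto (fun x => x ^ 2 * f x) atTop (𝓝 0)) :
    Tendsto f atTop (𝓝 0) := by
  have hinv : Tendsto (fun x : ℝ => (x ^ 2)⁻¹) atTop (𝓝 0) :=
    (tendsto_pow_atTop two_ne_zero).inv_tendsto_atTop
  have hprod := hinv.mul hf
  rw [mul_zero] at hprod
  refine hprod.congr' ?_
  filter_upwards [eventually_ne_atTop 0] with x hx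
  exact inv_mul_cancel_left₀ (pow_ne_zero 2 hx) _

theorem tendsto_sqDiff_of_tendsto_sq_mul (hf : Tendsto (fun x => x ^ 2 * f x) atTop (𝓝 0)) :
    Tendsto (sqDiff f) atTop (𝓝 0) := by
  have hlim : Tendsto (fun x => (x + 1) ^ 2 * f (x + 1)) atTop (𝓝 0) :=
    hf.comp (tendsto_atTop_add_const_right _ 1 tendsto_id)
  have hshift : Tendsto (fun x => x ^ 2 * f (x + 1)) atTop (𝓝 0) := by
    refine squeeze_zero_norm' ?_ (tendsto_zero_iff_norm_tendsto_zero.1 hlim)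
    filter_upwards [eventually_ge_atTop 0] with x hx
    rw [norm_mul, norm_mul, Real.norm_of_nonneg (sq_nonneg x),
      Real.norm_of_nonneg (sq_nonneg (x + 1))]
    gcongr
    linarith
  have hsub := hf.sub hshift
  rw [sub_zero] at hsub
  exact hsub.congr fun x => (mul_sub _ _ _).symm

end Telescoping

section Digamma

theorem hasDerivAt_deriv_of_contDiffOn_Ioi {f : ℝ → ℝ} (hf : ContDiffOn ℝ ∞ f (Ioi 0)) {x : ℝ}
    (hx : 0 < x) : HasDerivAt f (deriv f x) x :=
  ((hf.differentiableOn (by simp)).differentiableAt (Ioi_mem_nhds hx)).hasDerivAt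

theorem contDiffOn_deriv_Ioi {f : ℝ → ℝ} (hf : ContDiffOn ℝ ∞ f (Ioi 0)) :
    ContDiffOn ℝ ∞ (deriv f) (Ioi 0) :=
  ((contDiffOn_infty_iff_deriv_of_isOpen isOpen_Ioi).1 hf).2

theorem contDiffOn_Gamma : ContDiffOn ℝ ∞ Real.Gamma (Ioi 0) := by
  intro x hx
  have hGamma : Complex.Gamma x ≠ 0 := by
    rw [Complex.Gamma_ofReal, Complex.ofReal_ne_zero]
    exact (Real.Gamma_pos_of_pos hx).ne'
  have hsmooth : ContDiffAt ℂ ∞ (fun s => (Complex.Gamma s)⁻¹⁻¹) x :=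
    Complex.differentiable_one_div_Gamma.contDiff.contDiffAt.inv (inv_ne_zero hGamma)
  simp only [inv_inv] at hsmooth
  exact hsmooth.real_of_complex.contDiffWithinAt

theorem contDiffOn_psi : ContDiffOn ℝ ∞ psi (Ioi 0) :=
  (contDiffOn_deriv_Ioi contDiffOn_Gamma).div contDiffOn_Gamma
    fun _ hx => (Real.Gamma_pos_of_pos hx).ne'

theorem contDiffOn_deriv_psi : ContDiffOn ℝ ∞ (deriv psi) (Ioi 0) :=
  contDiffOn_deriv_Ioi contDiffOn_psi

theorem hasDerivAt_log_Gamma {x : ℝ} (hx : 0 < x) :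
    HasDerivAt (Real.log ∘ Real.Gamma) (psi x) x :=
  (hasDerivAt_deriv_of_contDiffOn_Ioi contDiffOn_Gamma hx).log (Real.Gamma_pos_of_pos hx).ne'

theorem deriv_log_Gamma {x : ℝ} (hx : 0 < x) : deriv (Real.log ∘ Real.Gamma) x = psi x :=
  (hasDerivAt_log_Gamma hx).deriv

theorem deriv_add_const_eq_add {f r : ℝ → ℝ} {a r' x : ℝ} (hf : DifferentiableAt ℝ f x)
    (hr : HasDerivAt r r' x) (h : (fun y => f (y + a)) =ᶠ[𝓝 x] fun y => f y + r y) :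
    deriv f (x + a) = deriv f x + r' := by
  rw [← deriv_comp_add_const, h.deriv_eq]
  exact (hf.hasDerivAt.add hr).deriv

theorem psi_add_one {x : ℝ} (hx : 0 < x) : psi (x + 1) = psi x + x⁻¹ := by
  rw [← deriv_log_Gamma hx, ← deriv_log_Gamma (by positivity : 0 < x + 1)]
  refine deriv_add_const_eq_add (hasDerivAt_log_Gamma hx).differentiableAt
    (Real.hasDerivAt_log hx.ne') ?_
  filter_upwards [Ioi_mem_nhds hx] with y (hy : 0 < y)
  simp only [Function.comp_apply]
  rw [Real.Gamma_add_one hy.ne', Real.log_mul hy.ne' (Real.Gamma_pos_of_pos hy).ne', add_comm]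

theorem deriv_psi_add_one {x : ℝ} (hx : 0 < x) :
    deriv psi (x + 1) = deriv psi x - 1 / x ^ 2 := by
  rw [sub_eq_add_neg, one_div]
  refine deriv_add_const_eq_add
    (hasDerivAt_deriv_of_contDiffOn_Ioi contDiffOn_psi hx).differentiableAt
    (hasDerivAt_inv hx.ne') ?_
  filter_upwards [Ioi_mem_nhds hx] with y hy using psi_add_one hy

theorem deriv_deriv_psi_add_one {x : ℝ} (hx : 0 < x) :
    deriv (deriv psi) (x + 1) = deriv (deriv psi) x + 2 / x ^ 3 := by
  have hpow : HasDerivAt (fun y : ℝ => -(1 / y ^ 2)) (2 / x ^ 3) x := by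
    convert! ((hasDerivAt_pow 2 x).inv (by positivity)).neg using 1
    · ext y
      simp
    · field_simp
      norm_num
  refine deriv_add_const_eq_add
    (hasDerivAt_deriv_of_contDiffOn_Ioi contDiffOn_deriv_psi hx).differentiableAt hpow ?_
  filter_upwards [Ioi_mem_nhds hx] with y hy
  rw [deriv_psi_add_one hy, sub_eq_add_neg]

theorem monotoneOn_psi : MonotoneOn psi (Ioi 0) :=
  (Real.convexOn_log_Gamma.monotoneOn_deriv fun _ hx =>
    (hasDerivAt_log_Gamma hx).differentiableAt).congr fun _ hx => deriv_log_Gamma hx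

theorem psi_add_natCast_sub_psi {x : ℝ} (hx : 0 < x) (n : ℕ) :
    psi (x + n) - psi x = ∑ k ∈ Finset.range n, (x + k)⁻¹ := by
  rw [← neg_sub, ← sum_range_sub_add_one, ← Finset.sum_neg_distrib]
  exact Finset.sum_congr rfl fun k _ => by
    rw [psi_add_one (by positivity : 0 < x + k)]
    ring

theorem tendsto_psi_add_sub_psi {h : ℝ} (hh : 0 < h) :
    Tendsto (fun x => psi (x + h) - psi x) atTop (𝓝 0) := by
  obtain ⟨n, hn⟩ := exists_nat_ge h
  have hsum : Tendsto (fun x : ℝ => ∑ k ∈ Finset.range n, (x + k)⁻¹) atTop (𝓝 0) := by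
    simpa using! tendsto_finsetSum (Finset.range n) fun (k : ℕ) _ =>
      (tendsto_atTop_add_const_right atTop (k : ℝ) tendsto_id).inv_tendsto_atTop
  refine tendsto_of_tendsto_of_tendsto_of_le_of_le' tendsto_const_nhds hsum ?_ ?_
  · filter_upwards [eventually_gt_atTop 0] with x hx
    exact sub_nonneg.2 (monotoneOn_psi hx (add_pos hx hh) (by linarith))
  · filter_upwards [eventually_gt_atTop 0] with x hx
    rw [← psi_add_natCast_sub_psi hx]
    gcongr
    exact monotoneOn_psi (add_pos hx hh) (by simp only [mem_Ioi]; positivity) (by linarith)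

theorem altDiffNonneg_psi_add_sub_psi {h : ℝ} (hh : 0 < h) :
    AltDiffNonneg fun x => psi (x + h) - psi x := by
  refine .of_sub_add_one (tendsto_psi_add_sub_psi hh)
    (((AltDiffNonneg.inv_add le_rfl).sub_comp_add_right hh).congr fun x hx => ?_)
  rw [add_right_comm x 1 h, psi_add_one hx, psi_add_one (add_pos hx hh)]
  ring

theorem altDiffNonneg_deriv_psi : AltDiffNonneg (deriv psi) :=
  .of_hasDerivAt (fun _ hx => hasDerivAt_deriv_of_contDiffOn_Ioi contDiffOn_psi hx)
    fun _ hh => altDiffNonneg_psi_add_sub_psi hh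

theorem altDiffNonneg_neg_deriv_deriv_psi : AltDiffNonneg fun x => -deriv (deriv psi) x :=
  altDiffNonneg_deriv_psi.neg_hasDerivAt
    fun _ hx => hasDerivAt_deriv_of_contDiffOn_Ioi contDiffOn_deriv_psi hx

theorem tendsto_zero_of_antitoneOn_of_hasDerivAt {f f' : ℝ → ℝ}
    (hderiv : ∀ x, 0 < x → HasDerivAt f (f' x) x) (hanti : AntitoneOn f' (Ioi 0))
    (hnonneg : ∀ x, 0 < x → 0 ≤ f' x) (hlim : Tendsto (fun x => f (x + 1) - f x) atTop (𝓝 0)) :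
    Tendsto f' atTop (𝓝 0) := by
  have hshift : Tendsto (fun x => f (x - 1 + 1) - f (x - 1)) atTop (𝓝 0) :=
    hlim.comp (tendsto_atTop_add_const_right _ (-1) tendsto_id)
  refine tendsto_of_tendsto_of_tendsto_of_le_of_le' tendsto_const_nhds hshift ?_ ?_
  · filter_upwards [eventually_gt_atTop 0] with x hx using hnonneg x hx
  · filter_upwards [eventually_gt_atTop 1] with x hx
    obtain ⟨c, ⟨hc₁, hc₂⟩, hc⟩ := exists_hasDerivAt_eq_slope f f' (sub_one_lt x)
      (fun y hy => (hderiv y (by linarith [hy.1])).continuousAt.continuousWithinAt)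
      (fun y hy => hderiv y (by linarith [hy.1]))
    rw [sub_sub_cancel, div_one] at hc
    rw [sub_add_cancel, ← hc]
    exact hanti (by simp only [mem_Ioi]; linarith) (by simp only [mem_Ioi]; linarith) hc₂.le

theorem tendsto_deriv_psi : Tendsto (deriv psi) atTop (𝓝 0) :=
  tendsto_zero_of_antitoneOn_of_hasDerivAt
    (fun _ hx => hasDerivAt_deriv_of_contDiffOn_Ioi contDiffOn_psi hx)
    altDiffNonneg_deriv_psi.antitoneOn (fun _ hx => altDiffNonneg_deriv_psi.nonneg hx)
    (tendsto_psi_add_sub_psi one_pos)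

theorem tendsto_deriv_deriv_psi : Tendsto (deriv (deriv psi)) atTop (𝓝 0) := by
  have hincr : Tendsto (fun x => -deriv psi (x + 1) - -deriv psi x) atTop (𝓝 0) := by
    simpa using! (tendsto_deriv_psi.comp
      (tendsto_atTop_add_const_right _ (1 : ℝ) tendsto_id)).neg.sub tendsto_deriv_psi.neg
  have hneg := tendsto_zero_of_antitoneOn_of_hasDerivAt (f := fun x => -deriv psi x)
    (fun _ hx => (hasDerivAt_deriv_of_contDiffOn_Ioi contDiffOn_deriv_psi hx).neg)
    altDiffNonneg_neg_deriv_deriv_psi.antitoneOn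
    (fun _ hx => altDiffNonneg_neg_deriv_deriv_psi.nonneg hx) hincr
  simpa using hneg.neg

theorem polygammaComb_eq : polygammaComb = fun x => deriv psi x ^ 2 + deriv (deriv psi) x := by
  ext x
  rw [polygammaComb, iteratedDeriv_succ, iteratedDeriv_one]

theorem contDiffOn_polygammaComb : ContDiffOn ℝ ∞ polygammaComb (Ioi 0) := by
  rw [polygammaComb_eq]
  exact (contDiffOn_deriv_psi.pow 2).add (contDiffOn_deriv_Ioi contDiffOn_deriv_psi)

theorem tendsto_polygammaComb : Tendsto polygammaComb atTop (𝓝 0) := by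
  rw [polygammaComb_eq]
  simpa using (tendsto_deriv_psi.pow 2).add tendsto_deriv_deriv_psi

theorem sqDiff_polygammaComb {x : ℝ} (hx : 0 < x) :
    sqDiff polygammaComb x = 2 * deriv psi x - 2 / x - 1 / x ^ 2 := by
  simp only [sqDiff, polygammaComb_eq]
  rw [deriv_psi_add_one hx, deriv_deriv_psi_add_one hx]
  field_simp
  ring

theorem tendsto_sqDiff_polygammaComb : Tendsto (sqDiff polygammaComb) atTop (𝓝 0) := by
  have hinv : Tendsto (fun x : ℝ => x⁻¹) atTop (𝓝 0) := tendsto_inv_atTop_zero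
  have hlim := ((tendsto_deriv_psi.const_mul 2).sub (hinv.const_mul 2)).sub (hinv.pow 2)
  simp only [mul_zero, sub_zero, ne_eq, OfNat.ofNat_ne_zero, not_false_eq_true, zero_pow] at hlim
  refine hlim.congr' ?_
  filter_upwards [eventually_gt_atTop 0] with x hx
  rw [sqDiff_polygammaComb hx, div_eq_mul_inv, one_div, inv_pow]

theorem sqDiffDiff_polygammaComb {x : ℝ} (hx : 0 < x) :
    sqDiffDiff polygammaComb x = 1 / (x ^ 2 * (x + 1) ^ 2) := by
  rw [sqDiffDiff, sqDiff_polygammaComb hx, sqDiff_polygammaComb (by positivity),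
    deriv_psi_add_one hx]
  field_simp
  ring

end Digamma

section RationalBounds

variable {q : ℝ → ℝ}

theorem altDiffNonneg_polygammaComb_sub (hlim : Tendsto (fun x => x ^ 2 * q x) atTop (𝓝 0))
    (hq : AltDiffNonneg fun x => 1 / (x ^ 2 * (x + 1) ^ 2) - sqDiffDiff q x) :
    AltDiffNonneg (polygammaComb - q) :=
  .sub_of_sqDiffDiff tendsto_polygammaComb tendsto_sqDiff_polygammaComb
    (tendsto_of_tendsto_sq_mul hlim) (tendsto_sqDiff_of_tendsto_sq_mul hlim)
    (hq.congr fun x hx => by rw [Pi.sub_apply, sqDiffDiff_polygammaComb hx])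

theorem altDiffNonneg_sub_polygammaComb (hlim : Tendsto (fun x => x ^ 2 * q x) atTop (𝓝 0))
    (hq : AltDiffNonneg fun x => sqDiffDiff q x - 1 / (x ^ 2 * (x + 1) ^ 2)) :
    AltDiffNonneg (q - polygammaComb) :=
  .sub_of_sqDiffDiff (tendsto_of_tendsto_sq_mul hlim) (tendsto_sqDiff_of_tendsto_sq_mul hlim)
    tendsto_polygammaComb tendsto_sqDiff_polygammaComb
    (hq.congr fun x hx => by rw [Pi.sub_apply, sqDiffDiff_polygammaComb hx])

theorem lt_polygammaComb (hlim : Tendsto (fun x => x ^ 2 * q x) atTop (𝓝 0))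
    (hq : ∀ x, 0 < x → sqDiffDiff q x < 1 / (x ^ 2 * (x + 1) ^ 2)) {x : ℝ} (hx : 0 < x) :
    q x < polygammaComb x :=
  lt_of_sqDiffDiff_lt (tendsto_of_tendsto_sq_mul hlim) (tendsto_sqDiff_of_tendsto_sq_mul hlim)
    tendsto_polygammaComb tendsto_sqDiff_polygammaComb
    (fun y hy => (hq y hy).trans_eq (sqDiffDiff_polygammaComb hy).symm) hx

theorem polygammaComb_lt (hlim : Tendsto (fun x => x ^ 2 * q x) atTop (𝓝 0))
    (hq : ∀ x, 0 < x → 1 / (x ^ 2 * (x + 1) ^ 2) < sqDiffDiff q x) {x : ℝ} (hx : 0 < x) :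
    polygammaComb x < q x :=
  lt_of_sqDiffDiff_lt tendsto_polygammaComb tendsto_sqDiff_polygammaComb
    (tendsto_of_tendsto_sq_mul hlim) (tendsto_sqDiff_of_tendsto_sq_mul hlim)
    (fun y hy => (sqDiffDiff_polygammaComb hy).trans_lt (hq y hy)) hx

/-- The rational function `(b x² + c x + d) / (12 x⁴ (x + 1)²)`. It is `ratBound c` for `b = 1`,
`d = 12`; other coefficients give the functions that show the constants in `ratBound` to be
optimal. -/
noncomputable def ratQuad (b c d x : ℝ) : ℝ :=
  (b * x ^ 2 + c * x + d) / (12 * x ^ 4 * (x + 1) ^ 2)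

theorem ratBound_eq_ratQuad (c : ℝ) : ratBound c = ratQuad 1 c 12 := by
  ext x
  rw [ratBound, ratQuad, one_mul]

theorem tendsto_sq_mul_ratQuad (b c d : ℝ) :
    Tendsto (fun x => x ^ 2 * ratQuad b c d x) atTop (𝓝 0) := by
  have hinv : Tendsto (fun x : ℝ => x⁻¹) atTop (𝓝 0) := tendsto_inv_atTop_zero
  have hinv' : Tendsto (fun x : ℝ => (x + 1)⁻¹) atTop (𝓝 0) :=
    (tendsto_atTop_add_const_right _ 1 tendsto_id).inv_tendsto_atTop
  have hlim := ((((hinv.const_mul c).const_add b).add ((hinv.pow 2).const_mul d)).div_const 12).mul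
    (hinv'.pow 2)
  rw [zero_pow two_ne_zero, mul_zero] at hlim
  refine hlim.congr' ?_
  filter_upwards [eventually_gt_atTop 0] with x hx
  rw [ratQuad]
  field_simp

theorem tendsto_sq_mul_ratBound (c : ℝ) : Tendsto (fun x => x ^ 2 * ratBound c x) atTop (𝓝 0) := by
  simpa only [ratBound_eq_ratQuad] using tendsto_sq_mul_ratQuad 1 c 12

-- The right-hand side is a Horner form in `1 / (x + 1)` and `1 / (x + 2)` with nonnegative
-- coefficients, so `AltDiffNonneg` can be read off; expanding numerator and denominator by
-- `(x + 2) (x + 3)` is what makes all the coefficients nonnegative.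
theorem inv_sub_sqDiffDiff_ratBound_zero {x : ℝ} (hx : 0 < x) :
    1 / (x ^ 2 * (x + 1) ^ 2) - sqDiffDiff (ratBound 0) x =
      3⁻¹ * ((x + 2)⁻¹ ^ 2 * (x + 3)⁻¹ ^ 3) *
        (((((((24 * (x + 1)⁻¹ + 60) * (x + 1)⁻¹ + 30) * (x + 1)⁻¹ + 1) * (x + 1)⁻¹ + 7) *
          (x + 2)⁻¹ + 22) * (x + 2)⁻¹ + 34) * (x + 2)⁻¹ + 20) := by
  simp only [sqDiffDiff, sqDiff, ratBound, (by ring : x + 1 + 1 = x + 2),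
    (by ring : x + 2 + 1 = x + 3)]
  field_simp
  ring

-- `x + 0` gives the innermost factor the shape required by `mul_inv_add_add_const`.
theorem sqDiffDiff_ratBound_four_sub_inv {x : ℝ} (hx : 0 < x) :
    sqDiffDiff (ratBound 4) x - 1 / (x ^ 2 * (x + 1) ^ 2) =
      3⁻¹ * ((x + 2)⁻¹ ^ 4 * (x + 3)⁻¹ ^ 2) *
        (((((144 * (x + 0)⁻¹ + 132) * (x + 1)⁻¹ + 128) * (x + 1)⁻¹ + 145) * (x + 1)⁻¹ + 115) *
          (x + 1)⁻¹ + 41) := by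
  simp only [sqDiffDiff, sqDiff, ratBound, (by ring : x + 1 + 1 = x + 2),
    (by ring : x + 2 + 1 = x + 3), add_zero]
  field_simp
  ring

theorem altDiffNonneg_inv_sub_sqDiffDiff_ratBound_zero :
    AltDiffNonneg fun x => 1 / (x ^ 2 * (x + 1) ^ 2) - sqDiffDiff (ratBound 0) x := by
  have hfactor : AltDiffNonneg fun x => 3⁻¹ * ((x + 2)⁻¹ ^ 2 * (x + 3)⁻¹ ^ 3) :=
    (AltDiffNonneg.const (by norm_num)).mul
      (((AltDiffNonneg.inv_add (by norm_num)).pow 2).mul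
        ((AltDiffNonneg.inv_add (by norm_num)).pow 3))
  refine (hfactor.mul ?_).congr fun x hx => (inv_sub_sqDiffDiff_ratBound_zero hx).symm
  iterate 7 refine AltDiffNonneg.mul_inv_add_add_const ?_ (by norm_num) (by norm_num)
  exact .const (by norm_num)

theorem altDiffNonneg_sqDiffDiff_ratBound_four_sub_inv :
    AltDiffNonneg fun x => sqDiffDiff (ratBound 4) x - 1 / (x ^ 2 * (x + 1) ^ 2) := by
  have hfactor : AltDiffNonneg fun x => 3⁻¹ * ((x + 2)⁻¹ ^ 4 * (x + 3)⁻¹ ^ 2) :=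
    (AltDiffNonneg.const (by norm_num)).mul
      (((AltDiffNonneg.inv_add (by norm_num)).pow 4).mul
        ((AltDiffNonneg.inv_add (by norm_num)).pow 2))
  refine (hfactor.mul ?_).congr fun x hx => (sqDiffDiff_ratBound_four_sub_inv hx).symm
  iterate 5 refine AltDiffNonneg.mul_inv_add_add_const ?_ (by norm_num) (by norm_num)
  exact .const (by norm_num)

theorem ratBound_zero_lt_polygammaComb {x : ℝ} (hx : 0 < x) : ratBound 0 x < polygammaComb x := by
  refine lt_polygammaComb (tendsto_sq_mul_ratBound 0) (fun y hy => ?_) hx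
  rw [← sub_pos, inv_sub_sqDiffDiff_ratBound_zero hy]
  positivity

theorem polygammaComb_lt_ratBound_four {x : ℝ} (hx : 0 < x) : polygammaComb x < ratBound 4 x := by
  refine polygammaComb_lt (tendsto_sq_mul_ratBound 4) (fun y hy => ?_) hx
  rw [← sub_pos, sqDiffDiff_ratBound_four_sub_inv hy]
  positivity

theorem ratQuad_one_four_zero_lt_polygammaComb {x : ℝ} (hx : 0 < x) :
    ratQuad 1 4 0 x < polygammaComb x := by
  refine lt_polygammaComb (tendsto_sq_mul_ratQuad 1 4 0) (fun y hy => ?_) hx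
  have hdiff : 1 / (y ^ 2 * (y + 1) ^ 2) - sqDiffDiff (ratQuad 1 4 0) y =
      (1728 + 7488 * y + 13368 * y ^ 2 + 12540 * y ^ 3 + 6500 * y ^ 4 + 1764 * y ^ 5 +
        196 * y ^ 6) / (12 * y ^ 2 * (y + 1) ^ 4 * (y + 2) ^ 4 * (y + 3) ^ 2) := by
    simp only [sqDiffDiff, sqDiff, ratQuad, (by ring : y + 1 + 1 = y + 2),
      (by ring : y + 2 + 1 = y + 3)]
    field_simp
    ring
  rw [← sub_pos, hdiff]
  positivity

theorem polygammaComb_lt_ratQuad_four_zero_twelve {x : ℝ} (hx : 0 < x) :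
    polygammaComb x < ratQuad 4 0 12 x := by
  refine polygammaComb_lt (tendsto_sq_mul_ratQuad 4 0 12) (fun y hy => ?_) hx
  have hdiff : sqDiffDiff (ratQuad 4 0 12) y - 1 / (y ^ 2 * (y + 1) ^ 2) =
      (28 + 472 * y + 1000 * y ^ 2 + 1120 * y ^ 3 + 736 * y ^ 4 + 256 * y ^ 5 + 36 * y ^ 6) /
        (12 * (y + 1) ^ 4 * (y + 2) ^ 4 * (y + 3) ^ 2) := by
    simp only [sqDiffDiff, sqDiff, ratQuad, (by ring : y + 1 + 1 = y + 2),
      (by ring : y + 2 + 1 = y + 3)]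
    field_simp
    ring
  rw [← sub_pos, hdiff]
  positivity

theorem ratQuad_le_ratQuad_iff {b c d b' c' d' x : ℝ} (hx : 0 < x) :
    ratQuad b c d x ≤ ratQuad b' c' d' x ↔
      b * x ^ 2 + c * x + d ≤ b' * x ^ 2 + c' * x + d' :=
  div_le_div_iff_of_pos_right (by positivity)

theorem le_zero_of_ratBound_le_polygammaComb {c : ℝ}
    (hc : ∀ x, 0 < x → ratBound c x ≤ polygammaComb x) : c ≤ 0 := by
  refine le_of_forall_pos_le_add fun ε hε => ?_
  have hx : 0 < ε / 3 := by positivity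
  have hle : ratQuad 1 c 12 (ε / 3) ≤ ratQuad 4 0 12 (ε / 3) :=
    ratBound_eq_ratQuad c ▸ (hc _ hx).trans (polygammaComb_lt_ratQuad_four_zero_twelve hx).le
  rw [ratQuad_le_ratQuad_iff hx] at hle
  nlinarith

theorem four_le_of_polygammaComb_le_ratBound {c : ℝ}
    (hc : ∀ x, 0 < x → polygammaComb x ≤ ratBound c x) : 4 ≤ c := by
  refine le_of_forall_pos_le_add fun ε hε => ?_
  have hx : 0 < 12 / ε := by positivity
  have hle : ratQuad 1 4 0 (12 / ε) ≤ ratQuad 1 c 12 (12 / ε) :=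
    ratBound_eq_ratQuad c ▸ (ratQuad_one_four_zero_lt_polygammaComb hx).le.trans (hc _ hx)
  rw [ratQuad_le_ratQuad_iff hx] at hle
  field_simp at hle
  nlinarith

theorem ratBound_sub_ratBound (a b : ℝ) {x : ℝ} (hx : 0 < x) :
    ratBound b x - ratBound a x = (b - a) / 12 * (x⁻¹ ^ 3 * (x + 1)⁻¹ ^ 2) := by
  rw [ratBound, ratBound]
  field_simp
  ring

theorem altDiffNonneg_ratBound_sub_ratBound {a b : ℝ} (hab : a ≤ b) :
    AltDiffNonneg fun x => ratBound b x - ratBound a x := by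
  have hinv : AltDiffNonneg fun x => x⁻¹ := by simpa using AltDiffNonneg.inv_add le_rfl
  have hcoeff : 0 ≤ (b - a) / 12 := div_nonneg (sub_nonneg.2 hab) (by norm_num)
  exact ((AltDiffNonneg.const hcoeff).mul
    ((hinv.pow 3).mul ((AltDiffNonneg.inv_add zero_le_one).pow 2))).congr
      fun x hx => (ratBound_sub_ratBound a b hx).symm

theorem ratBound_le_ratBound {a b x : ℝ} (hab : a ≤ b) (hx : 0 < x) :
    ratBound a x ≤ ratBound b x :=
  sub_nonneg.1 ((altDiffNonneg_ratBound_sub_ratBound hab).nonneg hx)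

theorem altDiffNonneg_fLam {c : ℝ} (hc : c ≤ 0) : AltDiffNonneg (fLam c) :=
  ((altDiffNonneg_polygammaComb_sub (tendsto_sq_mul_ratBound 0)
    altDiffNonneg_inv_sub_sqDiffDiff_ratBound_zero).add
      (altDiffNonneg_ratBound_sub_ratBound hc)).congr fun _ _ => sub_add_sub_cancel _ _ _

theorem altDiffNonneg_neg_fLam {c : ℝ} (hc : 4 ≤ c) : AltDiffNonneg fun x => -fLam c x :=
  ((altDiffNonneg_ratBound_sub_ratBound hc).add
    (altDiffNonneg_sub_polygammaComb (tendsto_sq_mul_ratBound 4)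
      altDiffNonneg_sqDiffDiff_ratBound_four_sub_inv)).congr
        fun _ _ => (sub_add_sub_cancel _ _ _).trans (neg_sub _ _).symm

theorem contDiffOn_fLam (c : ℝ) : ContDiffOn ℝ ∞ (fLam c) (Ioi 0) := by
  have hratBound : ContDiffOn ℝ ∞ (ratBound c) (Ioi 0) :=
    ContDiffOn.div (by fun_prop) (by fun_prop) fun x (hx : 0 < x) => by positivity
  exact contDiffOn_polygammaComb.sub hratBound

end RationalBounds

theorem theorem1 :
    (∀ lam : ℝ, CompletelyMonotonicOn (fLam lam) (Set.Ioi 0) ↔ lam ≤ 0) ∧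
    (∀ lam : ℝ, CompletelyMonotonicOn (fun x => -fLam lam x) (Set.Ioi 0) ↔ 4 ≤ lam) ∧
    (∀ μ ν : ℝ,
      (∀ x : ℝ, 0 < x →
        ratBound μ x < polygammaComb x ∧ polygammaComb x < ratBound ν x) ↔
      (μ ≤ 0 ∧ 4 ≤ ν)) := by
  refine ⟨fun lam => ⟨fun h => ?_, fun h => ?_⟩, fun lam => ⟨fun h => ?_, fun h => ?_⟩,
    fun μ ν => ⟨fun h => ⟨?_, ?_⟩, fun ⟨hμ, hν⟩ x hx => ⟨?_, ?_⟩⟩⟩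
  · exact le_zero_of_ratBound_le_polygammaComb fun x hx => sub_nonneg.1 (h.nonneg hx)
  · exact (altDiffNonneg_fLam h).completelyMonotonicOn (contDiffOn_fLam lam)
  · exact four_le_of_polygammaComb_le_ratBound fun x hx =>
      sub_nonpos.1 (neg_nonneg.1 (h.nonneg hx))
  · exact (altDiffNonneg_neg_fLam h).completelyMonotonicOn (contDiffOn_fLam lam).neg
  · exact le_zero_of_ratBound_le_polygammaComb fun x hx => (h x hx).1.le
  · exact four_le_of_polygammaComb_le_ratBound fun x hx => (h x hx).2.le
  · exact (ratBound_le_ratBound hμ hx).trans_lt (ratBound_zero_lt_polygammaComb hx)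
  · exact (polygammaComb_lt_ratBound_four hx).trans_le (ratBound_le_ratBound hν hx)
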